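/- Let $d\ge 0$, $\theta^*\in\mathbb R^d$, $\sigma>0$, $\delta>0$, and let $(\mathcal F_t)_{t\ge 0}$ be an increasing sequence of $\sigma$-fields on a probability space. For each horizon $n$ one observes $(x_t,y_t)\in\mathbb R^d\times\mathbb R$, $1\le t\le n$, with $$y_t=x_t^\top\theta^*+\epsilon_t ,\qquad \sigma(x_1,y_1,\dots,x_{t-1},y_{t-1},x_t)\subseteq\mathcal F_{t-1}\qquad(1\le t\le n),$$ where the noise sequence $(\epsilon_t)_{t\ge1}$ satisfies, for all $t\ge 1$, $$\mathbb E[\epsilon_t\mid\mathcal F_{t-1}]=0,\qquad \mathbb E[\epsilon_t^2\mid\mathcal F_{t-1}]=\sigma^2,\qquad\text{and}\qquad \sup_{t\ge1}\mathbb E\big[|\epsilon_t/\sigma|^{2+\delta}\mid\mathcal F_{t-1}\big]<\infty\quad\text{almost surely}.$$ The data $x_t=x_{n,t}$, $y_t=y_{n,t}$ are allowed to depend on $n$. Let $w_t=w_{n,t}\in\mathbb R^d$, $1\le t\le n$, be weights, which may depend on $n$, such that $w_t$ is $\mathcal F_{t-1}$-measurable, and put $W_n=(w_1,\dots,w_n)^\top\in\mathbb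 R^{n\times d}$, $X_n=(x_1,\dots,x_n)^\top\in\mathbb R^{n\times d}$. Suppose that, as $n\to\infty$, $$\max_{t\le n}\|w_t\|_2=o_p(1)\qquad\text{and}\qquad \|I_d-W_n^\top W_n\|_{\mathrm{op}}=o_p(1).$$ For $n\ge d$ let $W_n=U_w\Lambda_wV_w^\top$ be a singular value decomposition ($U_w\in\mathbb R^{n\times d}$ with $U_w^\top U_w=I_d$, $\Lambda_w\in\mathbb R^{d\times d}$ diagonal with nonnegative entries, $V_w\in\mathbb R^{d\times d}$ orthogonal), and let $A_w=V_wU_w^\top X_n$. Let $\hat\theta_{\mathrm{ALEE}}$ be an estimator that, with probability tending to $1$, solves the adaptive linear estimating equation $$\sum_{t=1}^n w_t\,(y_t-x_t^\top\hat\theta_{\mathrm{ALEE}})=0 ,$$ and let $\hat\sigma$ be any consistent estimator of $\sigma$, that is, $\hat\sigma\to\sigma$ in probability. Then $$A_w(\hat\theta_{\mathrm{ALEE}}-\theta^*)/\hat\sigma\ \overset{d}{\longrightarrow}\ \mathcal N(0,I_d)\qquad\text{as } n\to\infty .$$ -/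

import Mathlib

open MeasureTheory ProbabilityTheory Filter Topology
open scoped Matrix ENNReal

namespace ALEE

variable {Ω : Type*} {mΩ : MeasurableSpace Ω} {d : ℕ}

/-- The `n × d` matrix `(a₁, …, aₙ)ᵀ` whose rows are the first `n` vectors of a sequence
`(aₜ)_{t ≥ 1}` in `ℝᵈ`; the row with index `i : Fin n` is the vector of time `t = i + 1`. -/
def rowMatrix (n : ℕ) (a : ℕ → EuclideanSpace ℝ (Fin d)) : Matrix (Fin n) (Fin d) ℝ :=
  Matrix.of fun i j => a (i + 1) j

/-- The adaptive linear model. At every horizon `n` the data are `(xₜ, yₜ)`, `1 ≤ t ≤ n`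
(`x n t`, `y n t`), with `yₜ = xₜᵀ θ* + εₜ`, and the `σ`-field generated by
`x₁, y₁, …, xₜ₋₁, yₜ₋₁, xₜ` is contained in `ℱₜ₋₁`. The data may depend on the horizon;
the case of a single data sequence is that of `x` and `y` constant in `n`. -/
structure AdaptiveLinearModel (ℱ : Filtration ℕ mΩ) (x : ℕ → ℕ → Ω → EuclideanSpace ℝ (Fin d))
    (y : ℕ → ℕ → Ω → ℝ) (ε : ℕ → Ω → ℝ) (θ : EuclideanSpace ℝ (Fin d)) : Prop where
  response_eq : ∀ n t, 1 ≤ t → t ≤ n → ∀ ω, y n t ω = inner ℝ (x n t ω) θ + ε t ω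
  measurable_covariate : ∀ n t, 1 ≤ t → t ≤ n →
    ∀ s, 1 ≤ s → s ≤ t → Measurable[ℱ (t - 1)] (x n s)
  measurable_response : ∀ n t, 1 ≤ t → t ≤ n →
    ∀ s, 1 ≤ s → s < t → Measurable[ℱ (t - 1)] (y n s)

/-- The noise condition: for all `t ≥ 1`, `E[εₜ | ℱₜ₋₁] = 0` and `E[εₜ² | ℱₜ₋₁] = σ²`, and
`sup_{t ≥ 1} E[|εₜ/σ|^(2+δ) | ℱₜ₋₁] < ∞` almost surely. The last conditional expectation is
that of a nonnegative variable, with values in `[0, ∞]`; no moment of order `2 + δ` is assumed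
to be finite unconditionally. -/
structure NoiseCondition (P : Measure Ω) (ℱ : Filtration ℕ mΩ) (ε : ℕ → Ω → ℝ)
    (σ δ : ℝ) : Prop where
  memLp_two : ∀ t, 1 ≤ t → MemLp (ε t) 2 P
  condExp_eq_zero : ∀ t, 1 ≤ t → P[ε t | ℱ (t - 1)] =ᵐ[P] fun _ => (0 : ℝ)
  condExp_sq : ∀ t, 1 ≤ t → P[fun ω => ε t ω ^ 2 | ℱ (t - 1)] =ᵐ[P] fun _ => σ ^ 2
  condMoment_lt_top : ∀ᵐ ω ∂P,
    (⨆ t : {t : ℕ // 1 ≤ t},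
      (P⁻[fun ω' => ENNReal.ofReal (|ε t ω' / σ| ^ (2 + δ)) | ℱ (t - 1)]) ω) < ∞

/-- The weights `w₁, …, wₙ` used at horizon `n` are predictable: `wₜ` is `ℱₜ₋₁`-measurable. -/
def PredictableWeights (ℱ : Filtration ℕ mΩ) (w : ℕ → ℕ → Ω → EuclideanSpace ℝ (Fin d)) : Prop :=
  ∀ n t, 1 ≤ t → t ≤ n → Measurable[ℱ (t - 1)] (w n t)

/-- The stability condition on the weights: `max_{t ≤ n} ‖wₜ‖₂ = o_p(1)` and
`‖I_d - Wₙᵀ Wₙ‖_op = o_p(1)`. -/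
structure StableWeights (P : Measure Ω) (w : ℕ → ℕ → Ω → EuclideanSpace ℝ (Fin d)) : Prop where
  max_norm : TendstoInMeasure P (fun n ω => ⨆ i : Fin n, ‖w n (i + 1) ω‖) atTop fun _ => (0 : ℝ)
  gram : TendstoInMeasure P
    (fun n ω => ‖Matrix.toEuclideanCLM (𝕜 := ℝ)
      ((1 : Matrix (Fin d) (Fin d) ℝ)
        - (rowMatrix n fun t => w n t ω)ᵀ * (rowMatrix n fun t => w n t ω))‖)
    atTop fun _ => (0 : ℝ)

/-- `θhat` solves the estimating equation `∑_{t=1}^n wₜ (yₜ - xₜᵀ θhat) = 0`. -/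
def SolvesALEE (n : ℕ) (w x : ℕ → EuclideanSpace ℝ (Fin d)) (y : ℕ → ℝ)
    (θhat : EuclideanSpace ℝ (Fin d)) : Prop :=
  ∑ t ∈ Finset.Icc 1 n, (y t - inner ℝ (x t) θhat) • w t = 0

/-- `W = U Λ Vᵀ` is a (thin) singular value decomposition of the `n × d` matrix `W`: `U` is
`n × d` with orthonormal columns, `Λ` is diagonal with the entries `l j ≥ 0`, and `V` is
orthogonal. It exists for every `W` as soon as `d ≤ n`. -/
structure IsSVD {n : ℕ} (W U : Matrix (Fin n) (Fin d) ℝ) (l : Fin d → ℝ)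
    (V : Matrix (Fin d) (Fin d) ℝ) : Prop where
  left_orthonormal : Uᵀ * U = 1
  right_orthogonal : V ∈ Matrix.orthogonalGroup (Fin d) ℝ
  nonneg : ∀ j, 0 ≤ l j
  eq_mul : W = U * Matrix.diagonal l * Vᵀ

/-- The matrix `A_w = V_w U_wᵀ Xₙ`. -/
def affinityMatrix {n : ℕ} (U X : Matrix (Fin n) (Fin d) ℝ) (V : Matrix (Fin d) (Fin d) ℝ) :
    Matrix (Fin d) (Fin d) ℝ :=
  V * Uᵀ * X

/-- The normalized error `A_w (θhat - θ*) / σhat` at horizon `n`. -/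
noncomputable def normalizedError {n : ℕ} (U X : Matrix (Fin n) (Fin d) ℝ)
    (V : Matrix (Fin d) (Fin d) ℝ) (θhat θ : EuclideanSpace ℝ (Fin d)) (σhat : ℝ) :
    EuclideanSpace ℝ (Fin d) :=
  σhat⁻¹ • Matrix.toEuclideanCLM (𝕜 := ℝ) (affinityMatrix U X V) (θhat - θ)

end ALEE

/-! Write `S n = ∑ₜ (εₜ/σ) wₜ`. Substituting the model into the estimating equation gives `Wᵀ X
(θhat - θ) = σ S n`. For any decomposition `W = U Λ Vᵀ` with `Λ` invertible, `V Λ⁻¹ Vᵀ Wᵀ X = V Uᵀ X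
= A_w`, so the normalized error is `(σ/σhat) V Λ⁻¹ Vᵀ (S n)` (`normalizedError_eq`). Since `Wᵀ W` is
close to the identity, all singular values are close to one and `V Λ⁻¹ Vᵀ` is close to the identity.
As `σ/σhat` tends to one in probability and `S n` is tight, the error differs from `S n` by
`o_p(1)`.

It remains to prove that `S n` is asymptotically standard Gaussian. For fixed `u`, `⟨S n, u⟩ = ∑ aₜ
eₜ` with predictable `aₜ = ⟨wₜ, u⟩` and `eₜ = εₜ/σ`; stability makes `max |aₜ|` small and `∑ aₜ²`
close to `‖u‖²`. The process `exp (i ∑ aₜ eₜ + ∑ aₜ²/2)` is almost a martingale: each step changes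
its expectation by at most a constant times `η^δ E[aₜ²]` when `|aₜ| ≤ η`, and these errors sum to
order `η^δ` (`norm_integral_exp_martingale_sub_one_le`). The bounds this needs hold only with high
probability, so coefficients failing a predictable test are first set to zero
(`norm_integral_exp_mul_exp_sub_one_le`). -/

namespace ALEE

/-! ### Conditional expectations and the one-step Taylor estimate. -/

section ConditionalExpectation

variable {Ω : Type*} {m mΩ : MeasurableSpace Ω} {P : Measure Ω}

/-- Second-order Taylor bound for the exponential of an imaginary number, with a remainder of
order `2 + δ`, `0 < δ ≤ 1`. -/
lemma norm_exp_mul_I_sub_taylor_two_le {δ : ℝ} (hδ : 0 ≤ δ) (hδ1 : δ ≤ 1) (x : ℝ) :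
    ‖Complex.exp (x * Complex.I) - 1 - x * Complex.I + x ^ 2 / 2‖ ≤ 3 * |x| ^ (2 + δ) := by
  rcases le_total |x| 1 with hx | hx
  · have h := Complex.exp_bound (x := x * Complex.I) (by simpa using hx) (n := 3) (by norm_num)
    have e : Complex.exp (x * Complex.I) - ∑ k ∈ Finset.range 3, (x * Complex.I) ^ k / k.factorial
        = Complex.exp (x * Complex.I) - 1 - x * Complex.I + x ^ 2 / 2 := by
      simp [Finset.sum_range_succ, mul_pow]
      ring
    rw [e] at h
    have h3 : |x| ^ (3 : ℝ) ≤ |x| ^ (2 + δ) := by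
      rcases (abs_nonneg x).eq_or_lt with h0 | h0
      · rw [← h0, Real.zero_rpow (by norm_num), Real.zero_rpow (by positivity)]
      · exact Real.rpow_le_rpow_of_exponent_ge h0 hx (by linarith)
    have h3' : |x| ^ (3 : ℝ) = |x| ^ 3 := by exact_mod_cast Real.rpow_natCast |x| 3
    refine h.trans ?_
    have hn : ‖(x : ℂ) * Complex.I‖ = |x| := by simp
    rw [hn]
    have : 0 ≤ |x| ^ 3 := by positivity
    norm_num [Nat.factorial]
    rw [h3'] at h3
    linarith
  · have h1 : ‖Complex.exp (x * Complex.I) - 1‖ ≤ |x| := by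
      rw [mul_comm]
      exact Real.norm_exp_I_mul_ofReal_sub_one_le
    have h2 : |x| ^ (2 : ℝ) ≤ |x| ^ (2 + δ) :=
      Real.rpow_le_rpow_of_exponent_le hx (by linarith)
    rw [Real.rpow_two] at h2
    calc ‖Complex.exp (x * Complex.I) - 1 - x * Complex.I + x ^ 2 / 2‖
        ≤ ‖Complex.exp (x * Complex.I) - 1‖ + ‖(x : ℂ) * Complex.I‖ + ‖(x : ℂ) ^ 2 / 2‖ :=
          (norm_add_le _ _).trans (by gcongr; exact norm_sub_le _ _)
      _ ≤ |x| + |x| + |x| ^ 2 / 2 := by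
          gcongr
          · simp
          · simp
      _ ≤ 3 * |x| ^ (2 + δ) := by nlinarith

lemma abs_one_sub_half_sq_sub_exp_le {δ η a : ℝ} (hδ1 : δ ≤ 1) (hη : 0 < η)
    (hη1 : η ≤ 1) (ha : |a| ≤ η) :
    |1 - a ^ 2 / 2 - Real.exp (-(a ^ 2 / 2))| ≤ η ^ δ * a ^ 2 := by
  have ha2 : a ^ 2 ≤ η ^ 2 := by
    rw [← sq_abs]
    gcongr
  have h1 : |-(a ^ 2 / 2)| ≤ 1 := by
    rw [abs_neg, abs_of_nonneg (by positivity)]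
    nlinarith
  have h := Real.abs_exp_sub_one_sub_id_le h1
  have e : 1 - a ^ 2 / 2 - Real.exp (-(a ^ 2 / 2))
      = -(Real.exp (-(a ^ 2 / 2)) - 1 - -(a ^ 2 / 2)) := by ring
  rw [e, abs_neg]
  have hηδ : η ^ (1 : ℝ) ≤ η ^ δ := Real.rpow_le_rpow_of_exponent_ge hη hη1 hδ1
  rw [Real.rpow_one] at hηδ
  calc _ ≤ (-(a ^ 2 / 2)) ^ 2 := h
    _ = a ^ 2 / 4 * a ^ 2 := by ring
    _ ≤ η ^ δ * a ^ 2 := by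
      gcongr
      nlinarith

/-- Pull-out property of the conditional Lebesgue expectation, integrated. -/
lemma lintegral_mul_condLExp (hm : m ≤ mΩ) [IsFiniteMeasure P] {f X : Ω → ℝ≥0∞}
    (hf : Measurable[m] f) (hX : Measurable X) :
    ∫⁻ ω, f ω * X ω ∂P = ∫⁻ ω, f ω * (P⁻[X | m]) ω ∂P := by
  -- The measures with densities `X` and `P⁻[X | m]` agree on `m`-measurable sets, hence integrate
  -- every `m`-measurable `f` alike; no integrability is needed.
  have key : (P.withDensity X).trim hm = (P.withDensity (P⁻[X | m])).trim hm := by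
    refine @Measure.ext _ m _ _ fun s hs => ?_
    rw [trim_measurableSet_eq hm hs, trim_measurableSet_eq hm hs, withDensity_apply _ (hm s hs),
      withDensity_apply _ (hm s hs), setLIntegral_condLExp hm P X hs]
  have h (Y : Ω → ℝ≥0∞) (hY : Measurable Y) :
      ∫⁻ ω, f ω * Y ω ∂P = ∫⁻ ω, f ω ∂(P.withDensity Y).trim hm := by
    rw [lintegral_trim hm hf, lintegral_withDensity_eq_lintegral_mul _ hY (hf.mono hm le_rfl)]
    simp [mul_comm]
  rw [h X hX, key, ← h _ (measurable_condLExp' m P X)]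

/-- The bounded factor `Y` is known given `m` and pulls out of the conditional expectation. This
removes the first and second order Taylor terms below. -/
lemma integral_smul_eq_zero_of_condExp_eq_zero (hm : m ≤ mΩ) [IsFiniteMeasure P] {f : Ω → ℝ}
    {Y : Ω → ℂ} {B : ℝ} (hf : Integrable f P) (hf0 : P[f | m] =ᵐ[P] fun _ => (0 : ℝ))
    (hY : StronglyMeasurable[m] Y) (hB : ∀ ω, ‖Y ω‖ ≤ B) :
    Integrable (fun ω => f ω • Y ω) P ∧ ∫ ω, f ω • Y ω ∂P = 0 := by
  have hint : Integrable (f • Y) P :=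
    hf.smul_bdd B (hY.mono hm).aestronglyMeasurable (ae_of_all _ hB)
  refine ⟨hint, ?_⟩
  have h := condExp_smul_of_aestronglyMeasurable_right (m := m) hf hint hY.aestronglyMeasurable
  change ∫ ω, (f • Y) ω ∂P = 0
  rw [← integral_condExp hm, integral_congr_ae h]
  rw [integral_eq_zero_of_ae]
  filter_upwards [hf0] with ω hω
  simp [hω]

/-- Pointwise `|e|^p ≤ 1 + |e|^q`. It allows the exponent `δ` to be lowered to at most one, as the
Taylor bound requires. -/
lemma condLExp_rpow_le_one_add (hm : m ≤ mΩ) [IsFiniteMeasure P] {e : Ω → ℝ} {p q : ℝ}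
    (hp : 0 ≤ p) (hpq : p ≤ q) :
    P⁻[fun ω => ENNReal.ofReal (|e ω| ^ p) | m]
      ≤ᵐ[P] fun ω => 1 + (P⁻[fun ω => ENNReal.ofReal (|e ω| ^ q) | m]) ω := by
  have h1 : P⁻[fun ω => ENNReal.ofReal (|e ω| ^ p) | m]
      ≤ᵐ[P] P⁻[(fun _ => 1) + fun ω => ENNReal.ofReal (|e ω| ^ q) | m] := by
    refine condLExp_mono (ae_of_all _ fun ω => ?_)
    simp only [Pi.add_apply]
    rw [← ENNReal.ofReal_one, ← ENNReal.ofReal_add zero_le_one (by positivity)]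
    refine ENNReal.ofReal_le_ofReal ?_
    rcases le_total |e ω| 1 with h | h
    · have := Real.rpow_le_one (abs_nonneg _) h hp
      have : 0 ≤ |e ω| ^ q := by positivity
      linarith
    · have := Real.rpow_le_rpow_of_exponent_le h hpq
      linarith
  have h2 := condLExp_add_left (P := P) (mΩ := m) (X := fun _ : Ω => (1 : ℝ≥0∞))
    (fun ω => ENNReal.ofReal (|e ω| ^ q)) aemeasurable_const
  filter_upwards [h1, h2] with ω h1 h2
  refine h1.trans (h2.trans_le ?_)
  rw [condLExp_const hm]
  simp

/-- One step of the characteristic function comparison: a conditionally centred variable `a e` with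
conditional variance `a²` has conditional characteristic function close to `exp (-a² / 2)`. -/
lemma norm_integral_mul_exp_sub_exp_le (hm : m ≤ mΩ) [IsProbabilityMeasure P] {a e : Ω → ℝ}
    {Y : Ω → ℂ} {B M η δ : ℝ} (hδ : 0 < δ) (hδ1 : δ ≤ 1) (hη : 0 < η) (hη1 : η ≤ 1)
    (hM : 0 ≤ M) (hB : 0 ≤ B) (ha : Measurable[m] a) (haη : ∀ ω, |a ω| ≤ η)
    (hem : Measurable e) (he : MemLp e 2 P) (he0 : P[e | m] =ᵐ[P] fun _ => (0 : ℝ))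
    (he1 : P[fun ω => e ω ^ 2 | m] =ᵐ[P] fun _ => (1 : ℝ))
    (hmom : ∀ᵐ ω ∂P, a ω ≠ 0 →
      (P⁻[fun ω' => ENNReal.ofReal (|e ω'| ^ (2 + δ)) | m]) ω ≤ ENNReal.ofReal M)
    (hY : StronglyMeasurable[m] Y) (hYB : ∀ ω, ‖Y ω‖ ≤ B) :
    ‖∫ ω, Y ω * (Complex.exp ((a ω * e ω : ℝ) * Complex.I)
        - (Real.exp (-(a ω ^ 2 / 2)) : ℝ)) ∂P‖
      ≤ B * (3 * M + 1) * η ^ δ * ∫ ω, a ω ^ 2 ∂P := by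
  have ha' : Measurable a := ha.mono hm le_rfl
  have hY' : Measurable Y := (hY.mono hm).measurable
  have ha2η : ∀ ω, a ω ^ 2 ≤ η ^ 2 := fun ω => by
    rw [← sq_abs]
    have := haη ω
    gcongr
  have ha2 : Integrable (fun ω => a ω ^ 2) P := by
    refine Integrable.of_bound (by fun_prop) (η ^ 2) (ae_of_all _ fun ω => ?_)
    rw [Real.norm_of_nonneg (by positivity)]
    exact ha2η ω
  have hei : Integrable e P := he.integrable one_le_two
  have he2i : Integrable (fun ω => e ω ^ 2) P := he.integrable_sq
  -- With `x = a e`, `exp (ix) - exp (-a²/2)` is the Taylor remainder of `exp (ix)`, plus `i a e`,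
  -- minus `(e² - 1) a²/2`, plus `1 - a²/2 - exp (-a²/2)`. The middle two terms integrate to zero
  -- against `Y`; `R₁` and `R₂` are the outer two.
  let R₁ : Ω → ℂ := fun ω => Y ω * (Complex.exp ((a ω * e ω : ℝ) * Complex.I) - 1
    - (a ω * e ω : ℝ) * Complex.I + ((a ω * e ω : ℝ) : ℂ) ^ 2 / 2)
  let R₂ : Ω → ℂ := fun ω => Y ω * ((1 - a ω ^ 2 / 2 - Real.exp (-(a ω ^ 2 / 2)) : ℝ) : ℂ)
  have hR₁bound : ∀ ω, ‖R₁ ω‖ ≤ (3 * B * |a ω| ^ (2 + δ)) * |e ω| ^ (2 + δ) := fun ω => by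
    calc ‖R₁ ω‖ ≤ B * (3 * |a ω * e ω| ^ (2 + δ)) := by
          rw [norm_mul]
          exact mul_le_mul (hYB ω) (norm_exp_mul_I_sub_taylor_two_le hδ.le hδ1 _)
            (norm_nonneg _) hB
      _ = _ := by
          rw [abs_mul, Real.mul_rpow (abs_nonneg _) (abs_nonneg _)]
          ring
  -- The moment of order `2 + δ` of `e` may be infinite, so the estimate is made in `[0, ∞]` after
  -- conditioning, and the integrability of `R₁` is read off from it.
  have hR₁lint : ∫⁻ ω, ENNReal.ofReal ‖R₁ ω‖ ∂P
      ≤ ENNReal.ofReal (B * (3 * M) * η ^ δ * ∫ ω, a ω ^ 2 ∂P) := by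
    calc ∫⁻ ω, ENNReal.ofReal ‖R₁ ω‖ ∂P
        ≤ ∫⁻ ω, ENNReal.ofReal (3 * B * |a ω| ^ (2 + δ))
            * ENNReal.ofReal (|e ω| ^ (2 + δ)) ∂P := by
          refine lintegral_mono fun ω => ?_
          rw [← ENNReal.ofReal_mul (by positivity)]
          exact ENNReal.ofReal_le_ofReal (hR₁bound ω)
      _ = ∫⁻ ω, ENNReal.ofReal (3 * B * |a ω| ^ (2 + δ))
            * (P⁻[fun ω' => ENNReal.ofReal (|e ω'| ^ (2 + δ)) | m]) ω ∂P := by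
          refine lintegral_mul_condLExp hm ?_ (by fun_prop)
          fun_prop
      _ ≤ ∫⁻ ω, ENNReal.ofReal (B * (3 * M) * η ^ δ * a ω ^ 2) ∂P := by
          refine lintegral_mono_ae ?_
          filter_upwards [hmom] with ω hω
          -- Where `a` vanishes the integrand is zero even if the conditional moment is infinite, by
          -- the convention `0 * ∞ = 0`.
          by_cases h0 : a ω = 0
          · have : (2 + δ) ≠ 0 := by positivity
            simp [h0, Real.zero_rpow this]
          · have h1 : |a ω| ^ (2 + δ) ≤ η ^ δ * a ω ^ 2 := by
              rw [add_comm, Real.rpow_add (abs_pos.2 h0), Real.rpow_two, sq_abs]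
              have := haη ω
              gcongr
            calc _ ≤ ENNReal.ofReal (3 * B * |a ω| ^ (2 + δ)) * ENNReal.ofReal M := by
                  gcongr
                  exact hω h0
              _ = ENNReal.ofReal (3 * B * M * |a ω| ^ (2 + δ)) := by
                  rw [← ENNReal.ofReal_mul (by positivity)]
                  congr 1
                  ring
              _ ≤ _ := by
                  refine ENNReal.ofReal_le_ofReal ?_
                  calc _ ≤ 3 * B * M * (η ^ δ * a ω ^ 2) := by gcongr
                    _ = _ := by ring
      _ = ENNReal.ofReal (B * (3 * M) * η ^ δ * ∫ ω, a ω ^ 2 ∂P) := by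
          rw [← integral_const_mul, ofReal_integral_eq_lintegral_ofReal (ha2.const_mul _)]
          exact ae_of_all _ fun ω => by positivity
  have hR₁int : Integrable R₁ P := by
    refine ⟨by fun_prop, ?_⟩
    simp_rw [HasFiniteIntegral, ← ofReal_norm]
    exact hR₁lint.trans_lt ENNReal.ofReal_lt_top
  have hR₁ : ‖∫ ω, R₁ ω ∂P‖ ≤ B * (3 * M) * η ^ δ * ∫ ω, a ω ^ 2 ∂P := by
    refine (norm_integral_le_lintegral_norm _).trans (ENNReal.toReal_le_of_le_ofReal ?_ hR₁lint)
    exact mul_nonneg (by positivity) (integral_nonneg fun ω => sq_nonneg _)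
  have hR₂bound : ∀ ω, ‖R₂ ω‖ ≤ B * η ^ δ * a ω ^ 2 := fun ω => by
    rw [norm_mul, Complex.norm_real, mul_assoc]
    exact mul_le_mul (hYB ω) (abs_one_sub_half_sq_sub_exp_le hδ1 hη hη1 (haη ω))
      (norm_nonneg _) hB
  have hR₂int : Integrable R₂ P :=
    (ha2.const_mul (B * η ^ δ)).mono' (by fun_prop) (ae_of_all _ hR₂bound)
  have hR₂ : ‖∫ ω, R₂ ω ∂P‖ ≤ B * η ^ δ * ∫ ω, a ω ^ 2 ∂P := by
    rw [← integral_const_mul]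
    exact norm_integral_le_of_norm_le (ha2.const_mul _) (ae_of_all _ hR₂bound)
  obtain ⟨hL₁, hL₁'⟩ := integral_smul_eq_zero_of_condExp_eq_zero hm (P := P) hei he0
    (Y := fun ω => Y ω * (a ω * Complex.I)) (B := B * η)
    (hY.mul (Measurable.stronglyMeasurable (by fun_prop))) (fun ω => by
      rw [norm_mul]
      refine mul_le_mul (hYB ω) ?_ (norm_nonneg _) hB
      simpa using haη ω)
  obtain ⟨hL₂, hL₂'⟩ := integral_smul_eq_zero_of_condExp_eq_zero hm (P := P)
    (f := fun ω => e ω ^ 2 - 1) (he2i.sub (integrable_const 1))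
    (by
      have h := condExp_sub he2i (integrable_const (μ := P) (1 : ℝ)) m
      filter_upwards [h, he1] with ω h h1
      refine h.trans ?_
      simp [h1, condExp_const hm])
    (Y := fun ω => Y ω * ((a ω : ℂ) ^ 2 / 2)) (B := B * η ^ 2)
    (hY.mul (Measurable.stronglyMeasurable (by fun_prop))) (fun ω => by
      rw [norm_mul]
      refine mul_le_mul (hYB ω) ?_ (norm_nonneg _) hB
      have h2 := ha2η ω
      have h3 := sq_nonneg (a ω)
      simp only [norm_div, norm_pow, Complex.norm_real, Real.norm_eq_abs, sq_abs,
        Complex.norm_ofNat]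
      linarith)
  have hsplit : ∀ ω, Y ω * (Complex.exp ((a ω * e ω : ℝ) * Complex.I)
        - (Real.exp (-(a ω ^ 2 / 2)) : ℝ))
      = R₁ ω + e ω • (Y ω * (a ω * Complex.I))
        - (e ω ^ 2 - 1) • (Y ω * ((a ω : ℂ) ^ 2 / 2)) + R₂ ω := fun ω => by
    simp only [R₁, R₂, Complex.real_smul]
    push_cast
    ring
  simp_rw [hsplit]
  have hi₁ : Integrable (fun ω => R₁ ω + e ω • (Y ω * (a ω * Complex.I))) P := hR₁int.add hL₁
  have hi₂ : Integrable (fun ω => R₁ ω + e ω • (Y ω * (a ω * Complex.I))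
      - (e ω ^ 2 - 1) • (Y ω * ((a ω : ℂ) ^ 2 / 2))) P := hi₁.sub hL₂
  rw [integral_add hi₂ hR₂int, integral_sub hi₁ hL₂, integral_add hR₁int hL₁, hL₁', hL₂', add_zero, sub_zero]
  refine (norm_add_le _ _).trans ((add_le_add hR₁ hR₂).trans_eq ?_)
  ring

end ConditionalExpectation

/-! ### Quantitative martingale central limit theorem. -/

section MartingaleCLT

variable {Ω : Type*} {mΩ : MeasurableSpace Ω} {P : Measure Ω}

lemma measurable_sum_range_of_adapted {ℱ : Filtration ℕ mΩ} {f : ℕ → Ω → ℝ} {n k : ℕ}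
    (hf : ∀ t < n, Measurable[ℱ k] (f t)) :
    Measurable[ℱ k] fun ω => ∑ t ∈ Finset.range n, f t ω :=
  Finset.measurable_fun_sum (m := ℱ k) _ fun t ht => hf t (Finset.mem_range.1 ht)

lemma norm_exp_add_mul_I_le {q C : ℝ} (s : ℝ) (hq : q ≤ C) :
    ‖Complex.exp ((q / 2 : ℝ) + s * Complex.I)‖ ≤ Real.exp (C / 2) := by
  rw [Complex.norm_exp]
  simp
  linarith

/-- For a martingale transform `∑ aₜ eₜ` with bounded quadratic variation and uniformly small
coefficients, `exp (i ∑ aₜ eₜ + ∑ aₜ² / 2)` has expectation close to one. -/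
theorem norm_integral_exp_martingale_sub_one_le [IsProbabilityMeasure P] (ℱ : Filtration ℕ mΩ)
    {a e : ℕ → Ω → ℝ} {n : ℕ} {C M η δ : ℝ} (hδ : 0 < δ) (hδ1 : δ ≤ 1) (hη : 0 < η) (hη1 : η ≤ 1)
    (hM : 0 ≤ M) (ha : ∀ t < n, Measurable[ℱ t] (a t)) (haη : ∀ t < n, ∀ ω, |a t ω| ≤ η)
    (hC : ∀ ω, ∑ t ∈ Finset.range n, a t ω ^ 2 ≤ C)
    (hem : ∀ t, Measurable[ℱ (t + 1)] (e t)) (he : ∀ t, MemLp (e t) 2 P)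
    (he0 : ∀ t, P[e t | ℱ t] =ᵐ[P] fun _ => (0 : ℝ))
    (he1 : ∀ t, P[fun ω => e t ω ^ 2 | ℱ t] =ᵐ[P] fun _ => (1 : ℝ))
    (hmom : ∀ t < n, ∀ᵐ ω ∂P, a t ω ≠ 0 →
      (P⁻[fun ω' => ENNReal.ofReal (|e t ω'| ^ (2 + δ)) | ℱ t]) ω ≤ ENNReal.ofReal M) :
    ‖∫ ω, Complex.exp (((∑ t ∈ Finset.range n, a t ω ^ 2) / 2 : ℝ)
        + (∑ t ∈ Finset.range n, a t ω * e t ω : ℝ) * Complex.I) ∂P - 1‖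
      ≤ Real.exp (C / 2) * (3 * M + 1) * η ^ δ * C := by
  have haM : ∀ t < n, Measurable (a t) := fun t ht => (ha t ht).mono (ℱ.le t) le_rfl
  have heM : ∀ t, Measurable (e t) := fun t => (hem t).mono (ℱ.le _) le_rfl
  have hC' : ∀ k ≤ n, ∀ ω, ∑ t ∈ Finset.range k, a t ω ^ 2 ≤ C := fun k hk ω =>
    (Finset.sum_le_sum_of_subset_of_nonneg (Finset.range_mono hk)
      fun _ _ _ => sq_nonneg _).trans (hC ω)
  have hQm : ∀ k ≤ n, Measurable fun ω => ∑ t ∈ Finset.range k, a t ω ^ 2 := fun k hk =>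
    Finset.measurable_fun_sum _ fun t ht =>
      (haM t ((Finset.mem_range.1 ht).trans_le hk)).pow_const 2
  have hSm : ∀ k ≤ n, Measurable fun ω => ∑ t ∈ Finset.range k, a t ω * e t ω := fun k hk =>
    Finset.measurable_fun_sum _ fun t ht =>
      (haM t ((Finset.mem_range.1 ht).trans_le hk)).mul (heM t)
  have ha2 : ∀ t < n, Integrable (fun ω => a t ω ^ 2) P := fun t ht => by
    refine Integrable.of_bound ((haM t ht).pow_const 2).aestronglyMeasurable (η ^ 2)
      (ae_of_all _ fun ω => ?_)
    rw [Real.norm_of_nonneg (by positivity), ← sq_abs]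
    have := haη t ht ω
    gcongr
  let Z : ℕ → Ω → ℂ := fun k ω => Complex.exp (((∑ t ∈ Finset.range k, a t ω ^ 2) / 2 : ℝ)
        + (∑ t ∈ Finset.range k, a t ω * e t ω : ℝ) * Complex.I)
  have hZint : ∀ k ≤ n, Integrable (Z k) P := fun k hk => by
    have h1 := hQm k hk
    have h2 := hSm k hk
    exact Integrable.of_bound (by fun_prop) (Real.exp (C / 2))
      (ae_of_all _ fun ω => norm_exp_add_mul_I_le _ (hC' k hk ω))
  have hstep : ∀ k ≤ n, ‖∫ ω, Z k ω ∂P - 1‖ ≤ Real.exp (C / 2) * (3 * M + 1) * η ^ δ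
      * ∑ t ∈ Finset.range k, ∫ ω, a t ω ^ 2 ∂P := by
    intro k
    induction k with
    | zero => simp [Z]
    | succ k ih =>
      intro hk
      have hkn : k < n := hk
      -- The quadratic variation runs one step further than the noise. As `a k` is predictable, `Y`
      -- is still `ℱ k`-measurable, while `Y exp (i aₖ eₖ) = Z (k + 1)` and `Y exp (-aₖ²/2) = Z k`.
      let Y : Ω → ℂ := fun ω => Complex.exp (((∑ t ∈ Finset.range (k + 1), a t ω ^ 2) / 2 : ℝ)
        + (∑ t ∈ Finset.range k, a t ω * e t ω : ℝ) * Complex.I)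
      have hQ : Measurable[ℱ k] fun ω => ∑ t ∈ Finset.range (k + 1), a t ω ^ 2 :=
        measurable_sum_range_of_adapted fun t ht =>
          ((ha t (by omega)).mono (ℱ.mono (by omega)) le_rfl).pow_const 2
      have hS : Measurable[ℱ k] fun ω => ∑ t ∈ Finset.range k, a t ω * e t ω :=
        measurable_sum_range_of_adapted fun t ht =>
          ((ha t (by omega)).mono (ℱ.mono (by omega)) le_rfl).mul
            ((hem t).mono (ℱ.mono (by omega)) le_rfl)
      have hY : Measurable[ℱ k] Y := by fun_prop
      have hone := norm_integral_mul_exp_sub_exp_le (ℱ.le k) hδ hδ1 hη hη1 hM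
        (Real.exp_pos (C / 2)).le (ha k hkn) (haη k hkn) (heM k) (he k) (he0 k) (he1 k)
        (hmom k hkn) hY.stronglyMeasurable (fun ω => norm_exp_add_mul_I_le _ (hC' (k + 1) hk ω))
      have hdiff : ∀ ω, Y ω * (Complex.exp ((a k ω * e k ω : ℝ) * Complex.I)
          - (Real.exp (-(a k ω ^ 2 / 2)) : ℝ)) = Z (k + 1) ω - Z k ω := fun ω => by
        simp only [Y, Z, mul_sub, Complex.ofReal_exp, ← Complex.exp_add]
        congr 2
        · simp only [Finset.sum_range_succ]
          push_cast
          ring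
        · simp only [Finset.sum_range_succ]
          push_cast
          ring
      simp_rw [hdiff] at hone
      rw [integral_sub (hZint _ hk) (hZint _ hkn.le)] at hone
      have e1 : ∫ ω, Z (k + 1) ω ∂P - 1 = (∫ ω, Z k ω ∂P - 1)
          + (∫ ω, Z (k + 1) ω ∂P - ∫ ω, Z k ω ∂P) := by ring
      rw [e1, Finset.sum_range_succ, mul_add]
      exact (norm_add_le _ _).trans (add_le_add (ih hkn.le) hone)
  refine (hstep n le_rfl).trans ?_
  rw [← integral_finsetSum _ fun t ht => ha2 t (Finset.mem_range.1 ht)]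
  gcongr
  calc ∫ ω, ∑ t ∈ Finset.range n, a t ω ^ 2 ∂P ≤ ∫ _, C ∂P :=
        integral_mono (integrable_finsetSum _ fun t ht => ha2 t (Finset.mem_range.1 ht))
          (integrable_const C) hC
    _ = C := by simp

/-- The test includes the current coefficient, so the retained sum never overshoots `C`; it remains
predictable because the coefficients are. -/
lemma sum_ite_sum_sq_le {a : ℕ → ℝ} {C : ℝ} (hC : 0 ≤ C) (p : ℕ → Prop) [DecidablePred p] (n : ℕ) :
    ∑ t ∈ Finset.range n,
      (if p t ∧ ∑ s ∈ Finset.range (t + 1), a s ^ 2 ≤ C then a t else 0) ^ 2 ≤ C := by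
  induction n with
  | zero => simpa
  | succ n ih =>
    by_cases h : ∑ s ∈ Finset.range (n + 1), a s ^ 2 ≤ C
    · refine (Finset.sum_le_sum fun t _ => ?_).trans h
      split_ifs
      · rfl
      · simpa using sq_nonneg _
    · rw [Finset.sum_range_succ, if_neg (fun h' => h h'.2)]
      simpa using ih

lemma abs_exp_half_sub_exp_half_le {q v C : ℝ} (hq : q ≤ C) (hv : v ≤ C) :
    |Real.exp (q / 2) - Real.exp (v / 2)| ≤ Real.exp (C / 2) * |q - v| := by
  wlog h : v ≤ q generalizing q v
  · rw [abs_sub_comm, abs_sub_comm q]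
    exact this hv hq (le_of_not_ge h)
  have h1 : Real.exp (v / 2) ≤ Real.exp (q / 2) := Real.exp_le_exp.2 (by linarith)
  rw [abs_of_nonneg (by linarith), abs_of_nonneg (by linarith)]
  have h2 := Real.add_one_le_exp (v / 2 - q / 2)
  have h3 : Real.exp (v / 2) = Real.exp (q / 2) * Real.exp (v / 2 - q / 2) := by
    rw [← Real.exp_add]
    congr 1
    ring
  have h4 : Real.exp (q / 2) ≤ Real.exp (C / 2) := Real.exp_le_exp.2 (by linarith)
  have h5 := Real.exp_pos (q / 2)
  have h6 : Real.exp (q / 2) * (v / 2 - q / 2 + 1) ≤ Real.exp (v / 2) := by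
    rw [h3]
    gcongr
  nlinarith

/-- Quantitative martingale central limit theorem: the characteristic function of `∑ aₜ eₜ` is
compared with that of a Gaussian variable of variance `v`, up to the probability that one of the
coefficients exceeds `η`, that a conditional moment of order `2 + δ` exceeds `M`, or that the
quadratic variation is not within `ρ` of `v`. -/
theorem norm_integral_exp_mul_exp_sub_one_le [IsProbabilityMeasure P] (ℱ : Filtration ℕ mΩ)
    {a e : ℕ → Ω → ℝ} {n : ℕ} {v M η ρ δ : ℝ} (hδ : 0 < δ) (hδ1 : δ ≤ 1) (hη : 0 < η) (hη1 : η ≤ 1)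
    (hM : 0 ≤ M) (hv : 0 ≤ v) (hρ : 0 ≤ ρ) (hρ1 : ρ ≤ 1) (ha : ∀ t < n, Measurable[ℱ t] (a t))
    (hem : ∀ t, Measurable[ℱ (t + 1)] (e t)) (he : ∀ t, MemLp (e t) 2 P)
    (he0 : ∀ t, P[e t | ℱ t] =ᵐ[P] fun _ => (0 : ℝ))
    (he1 : ∀ t, P[fun ω => e t ω ^ 2 | ℱ t] =ᵐ[P] fun _ => (1 : ℝ))
    {K : ℕ → Ω → ℝ≥0∞} (hK : ∀ t, Measurable[ℱ t] (K t))
    (hmom : ∀ t, P⁻[fun ω' => ENNReal.ofReal (|e t ω'| ^ (2 + δ)) | ℱ t] ≤ᵐ[P] K t) :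
    ‖(∫ ω, Complex.exp ((∑ t ∈ Finset.range n, a t ω * e t ω : ℝ) * Complex.I) ∂P)
        * (Real.exp (v / 2) : ℝ) - 1‖
      ≤ Real.exp ((v + 1) / 2) * (3 * M + 1) * η ^ δ * (v + 1) + Real.exp ((v + 1) / 2) * ρ
        + 2 * Real.exp ((v + 1) / 2) * P.real ({ω | ∃ t < n, η < |a t ω|}
          ∪ {ω | ∃ t, ENNReal.ofReal M < K t ω}
          ∪ {ω | ρ < |∑ t ∈ Finset.range n, a t ω ^ 2 - v|}) := by
  classical
  -- Since `ρ ≤ 1`, the quadratic variation is at most `v + 1` off the bad event, so the truncation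
  -- at `C` does nothing there.
  set C := v + 1
  set bad := {ω | ∃ t < n, η < |a t ω|} ∪ {ω | ∃ t, ENNReal.ofReal M < K t ω}
          ∪ {ω | ρ < |∑ t ∈ Finset.range n, a t ω ^ 2 - v|} with hbad
  have haM : ∀ t < n, Measurable (a t) := fun t ht => (ha t ht).mono (ℱ.le t) le_rfl
  have heM : ∀ t, Measurable (e t) := fun t => (hem t).mono (ℱ.le _) le_rfl
  have hKM : ∀ t, Measurable (K t) := fun t => (hK t).mono (ℱ.le _) le_rfl
  have hbadm : MeasurableSet bad := by
    refine (MeasurableSet.union ?_ ?_).union ?_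
    · have : {ω | ∃ t < n, η < |a t ω|} = ⋃ t : Fin n, {ω | η < |a t ω|} := by
        ext ω
        simp [Fin.exists_iff]
      rw [this]
      refine MeasurableSet.iUnion fun t => ?_
      have := haM t t.2
      exact measurableSet_lt measurable_const (by fun_prop)
    · rw [Set.ofPred_exists]
      exact MeasurableSet.iUnion fun t => measurableSet_lt measurable_const (hKM t)
    · have : Measurable fun ω => ∑ t ∈ Finset.range n, a t ω ^ 2 :=
        Finset.measurable_fun_sum _ fun t ht => (haM t (Finset.mem_range.1 ht)).pow_const 2
      exact measurableSet_lt measurable_const (by fun_prop)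
  let b : ℕ → Ω → ℝ := fun t ω => if (K t ω ≤ ENNReal.ofReal M ∧ |a t ω| ≤ η) ∧
    ∑ s ∈ Finset.range (t + 1), a s ω ^ 2 ≤ C then a t ω else 0
  have hb : ∀ t < n, Measurable[ℱ t] (b t) := fun t ht => by
    have h1 : Measurable[ℱ t] fun ω => ∑ s ∈ Finset.range (t + 1), a s ω ^ 2 :=
      measurable_sum_range_of_adapted fun s hs =>
        ((ha s (by omega)).mono (ℱ.mono (by omega)) le_rfl).pow_const 2
    have h2 := ha t ht
    have h3 : Measurable[ℱ t] fun ω => |a t ω| := by fun_prop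
    refine Measurable.ite (m := ℱ t) ?_ h2 measurable_const
    exact ((measurableSet_le (hK t) measurable_const).inter
      (measurableSet_le h3 measurable_const)).inter (measurableSet_le h1 measurable_const)
  have hbη : ∀ t < n, ∀ ω, |b t ω| ≤ η := fun t _ ω => by
    simp only [b]
    split_ifs with h
    · exact h.1.2
    · simpa using hη.le
  have hbC : ∀ ω, ∑ t ∈ Finset.range n, b t ω ^ 2 ≤ C := fun ω =>
    sum_ite_sum_sq_le (by positivity) _ n
  have hmain := norm_integral_exp_martingale_sub_one_le ℱ hδ hδ1 hη hη1 hM hb hbη hbC hem he he0 he1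
    (fun t _ => by
      filter_upwards [hmom t] with ω hω hne
      simp only [b, ne_eq, ite_eq_right_iff, Classical.not_imp] at hne
      exact hω.trans hne.1.1.1)
  have hgood : ∀ ω ∉ bad, ∀ t < n, b t ω = a t ω := fun ω hω t ht => by
    simp only [hbad, Set.mem_union, Set.mem_ofPred_eq, not_or, not_exists, not_and, not_lt] at hω
    refine if_pos ⟨⟨hω.1.2 t, hω.1.1 t ht⟩, ?_⟩
    have h1 := (abs_le.1 hω.2).2
    have h2 : ∑ s ∈ Finset.range (t + 1), a s ω ^ 2 ≤ ∑ s ∈ Finset.range n, a s ω ^ 2 :=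
      Finset.sum_le_sum_of_subset_of_nonneg (Finset.range_mono ht) fun _ _ _ => sq_nonneg _
    simp only [C]
    linarith
  have hbM : ∀ t < n, Measurable (b t) := fun t ht => (hb t ht).mono (ℱ.le t) le_rfl
  have hQm : Measurable fun ω => ∑ t ∈ Finset.range n, b t ω ^ 2 :=
    Finset.measurable_fun_sum _ fun t ht => (hbM t (Finset.mem_range.1 ht)).pow_const 2
  have hTm : Measurable fun ω => ∑ t ∈ Finset.range n, b t ω * e t ω :=
    Finset.measurable_fun_sum _ fun t ht => (hbM t (Finset.mem_range.1 ht)).mul (heM t)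
  have hSm : Measurable fun ω => ∑ t ∈ Finset.range n, a t ω * e t ω :=
    Finset.measurable_fun_sum _ fun t ht => (haM t (Finset.mem_range.1 ht)).mul (heM t)
  let Z : Ω → ℂ := fun ω => Complex.exp (((∑ t ∈ Finset.range n, b t ω ^ 2) / 2 : ℝ)
        + (∑ t ∈ Finset.range n, b t ω * e t ω : ℝ) * Complex.I)
  let X : Ω → ℂ := fun ω => Complex.exp ((v / 2 : ℝ)
        + (∑ t ∈ Finset.range n, a t ω * e t ω : ℝ) * Complex.I)
  have hZb : ∀ ω, ‖Z ω‖ ≤ Real.exp (C / 2) := fun ω => norm_exp_add_mul_I_le _ (hbC ω)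
  have hXb : ∀ ω, ‖X ω‖ ≤ Real.exp (C / 2) := fun ω =>
    norm_exp_add_mul_I_le _ (by simp [C])
  have hZint : Integrable Z P := Integrable.of_bound (by fun_prop) _ (ae_of_all _ hZb)
  have hXint : Integrable X P := Integrable.of_bound (by fun_prop) _ (ae_of_all _ hXb)
  have hXeq : (∫ ω, Complex.exp ((∑ t ∈ Finset.range n, a t ω * e t ω : ℝ) * Complex.I) ∂P)
        * (Real.exp (v / 2) : ℝ) = ∫ ω, X ω ∂P := by
    rw [← integral_mul_const]
    congr 1
    ext ω
    simp only [X]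
    rw [add_comm, Complex.exp_add, Complex.ofReal_exp]
  -- Off the bad event the phases coincide and only `exp (v/2)` and `exp (Q/2)` differ, with `Q`
  -- within `ρ` of `v`; on it both moduli are at most `exp (C/2)`.
  have hdiff : ∀ ω, ‖X ω - Z ω‖ ≤ Real.exp (C / 2) * ρ
      + bad.indicator (fun _ => 2 * Real.exp (C / 2)) ω := fun ω => by
    by_cases hω : ω ∈ bad
    · rw [Set.indicator_of_mem hω]
      have := norm_sub_le (X ω) (Z ω)
      have := hXb ω
      have := hZb ω
      have : 0 ≤ Real.exp (C / 2) * ρ := by positivity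
      linarith
    · rw [Set.indicator_of_notMem hω, add_zero]
      have hg := hgood ω hω
      have e1 : ∑ t ∈ Finset.range n, b t ω * e t ω = ∑ t ∈ Finset.range n, a t ω * e t ω :=
        Finset.sum_congr rfl fun t ht => by rw [hg t (Finset.mem_range.1 ht)]
      have e2 : ∑ t ∈ Finset.range n, b t ω ^ 2 = ∑ t ∈ Finset.range n, a t ω ^ 2 :=
        Finset.sum_congr rfl fun t ht => by rw [hg t (Finset.mem_range.1 ht)]
      have hbC' := hbC ω
      rw [e2] at hbC'
      simp only [X, Z, e1, e2]
      rw [Complex.exp_add, Complex.exp_add, ← sub_mul, norm_mul, Complex.norm_exp_ofReal_mul_I,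
        mul_one, ← Complex.ofReal_exp, ← Complex.ofReal_exp, ← Complex.ofReal_sub,
        Complex.norm_real, Real.norm_eq_abs, abs_sub_comm]
      refine (abs_exp_half_sub_exp_half_le hbC' (by simp [C])).trans ?_
      simp only [hbad, Set.mem_union, Set.mem_ofPred_eq, not_or, not_exists, not_and, not_lt] at hω
      have := hω.2
      gcongr
  have hXZ : ‖∫ ω, X ω ∂P - ∫ ω, Z ω ∂P‖
      ≤ Real.exp (C / 2) * ρ + 2 * Real.exp (C / 2) * P.real bad := by
    rw [← integral_sub hXint hZint]
    have hi : Integrable (bad.indicator fun _ => 2 * Real.exp (C / 2)) P :=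
      (integrable_const _).indicator hbadm
    refine (norm_integral_le_of_norm_le ((integrable_const _).add hi)
      (ae_of_all _ hdiff)).trans_eq ?_
    simp only [Pi.add_apply]
    rw [integral_add (integrable_const _) hi, integral_indicator_const _ hbadm]
    simp [mul_comm]
  rw [hXeq]
  have e3 : ∫ ω, X ω ∂P - 1 = (∫ ω, Z ω ∂P - 1) + (∫ ω, X ω ∂P - ∫ ω, Z ω ∂P) := by ring
  rw [e3, add_assoc]
  exact (norm_add_le _ _).trans (add_le_add hmain hXZ)

end MartingaleCLT

/-! ### Passage to the limit. -/

section Limit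

variable {Ω : Type*} {mΩ : MeasurableSpace Ω} {P : Measure Ω}

/-- The events decrease in `M`, and on their intersection the supremum is infinite; continuity from
above concludes. -/
lemma tendsto_measure_exists_lt_of_iSup_lt_top [IsFiniteMeasure P] {K : ℕ → Ω → ℝ≥0∞}
    (hK : ∀ t, Measurable (K t)) (hsup : ∀ᵐ ω ∂P, ⨆ t, K t ω < ∞) :
    Tendsto (fun M : ℕ => P {ω | ∃ t, ENNReal.ofReal M < K t ω}) atTop (𝓝 0) := by
  have hm : ∀ M : ℕ, MeasurableSet {ω | ∃ t, ENNReal.ofReal M < K t ω} := fun M => by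
    rw [Set.ofPred_exists]
    exact MeasurableSet.iUnion fun t => measurableSet_lt measurable_const (hK t)
  have hanti : Antitone fun M : ℕ => {ω | ∃ t, ENNReal.ofReal M < K t ω} := fun M N hMN ω => by
    rintro ⟨t, ht⟩
    exact ⟨t, lt_of_le_of_lt (ENNReal.ofReal_le_ofReal (by exact_mod_cast hMN)) ht⟩
  have h := tendsto_measure_iInter_atTop (μ := P) (fun M => (hm M).nullMeasurableSet) hanti
    ⟨0, measure_ne_top _ _⟩
  have h0 : P (⋂ M : ℕ, {ω | ∃ t, ENNReal.ofReal M < K t ω}) = 0 := by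
    refine measure_mono_null (fun ω hω => ?_) hsup
    simp only [Set.mem_iInter, Set.mem_ofPred_eq] at hω
    change ¬ (⨆ t, K t ω < ∞)
    rw [not_lt, top_le_iff]
    refine ENNReal.eq_top_of_forall_nnreal_le fun r => ?_
    obtain ⟨N, hN⟩ := exists_nat_ge r
    obtain ⟨t, ht⟩ := hω N
    refine le_trans ?_ (ht.le.trans (le_iSup (fun t => K t ω) t))
    rw [ENNReal.ofReal_natCast]
    exact_mod_cast hN
  rwa [h0] at h

/-- Martingale central limit theorem for arrays of martingale transforms of a fixed martingale
difference sequence, in terms of characteristic functions. -/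
theorem tendsto_integral_exp_martingale [IsProbabilityMeasure P] (ℱ : Filtration ℕ mΩ)
    {a : ℕ → ℕ → Ω → ℝ} {e : ℕ → Ω → ℝ} {v δ : ℝ} (hδ : 0 < δ) (hv : 0 ≤ v)
    (ha : ∀ n, ∀ t < n, Measurable[ℱ t] (a n t))
    (hem : ∀ t, Measurable[ℱ (t + 1)] (e t)) (he : ∀ t, MemLp (e t) 2 P)
    (he0 : ∀ t, P[e t | ℱ t] =ᵐ[P] fun _ => (0 : ℝ))
    (he1 : ∀ t, P[fun ω => e t ω ^ 2 | ℱ t] =ᵐ[P] fun _ => (1 : ℝ))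
    (hmom : ∀ᵐ ω ∂P,
      ⨆ t, (P⁻[fun ω' => ENNReal.ofReal (|e t ω'| ^ (2 + δ)) | ℱ t]) ω < ∞)
    (hmax : ∀ η : ℝ, 0 < η → Tendsto (fun n => P {ω | ∃ t < n, η < |a n t ω|}) atTop (𝓝 0))
    (hvar : ∀ ρ : ℝ, 0 < ρ →
      Tendsto (fun n => P {ω | ρ < |∑ t ∈ Finset.range n, a n t ω ^ 2 - v|}) atTop (𝓝 0)) :
    Tendsto (fun n => ∫ ω, Complex.exp ((∑ t ∈ Finset.range n, a n t ω * e t ω : ℝ)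
      * Complex.I) ∂P) atTop (𝓝 (Complex.exp (-v / 2 : ℝ))) := by
  set δ' := min δ 1
  have hδ' : 0 < δ' := lt_min hδ one_pos
  set φ : ℕ → ℂ := fun n => ∫ ω, Complex.exp ((∑ t ∈ Finset.range n, a n t ω * e t ω : ℝ)
      * Complex.I) ∂P
  let K : ℕ → Ω → ℝ≥0∞ := fun t ω =>
    1 + (P⁻[fun ω' => ENNReal.ofReal (|e t ω'| ^ (2 + δ)) | ℱ t]) ω
  have hK : ∀ t, Measurable[ℱ t] (K t) := fun t =>
    (measurable_condLExp (ℱ t) P _).const_add 1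
  have hmomK : ∀ t, P⁻[fun ω' => ENNReal.ofReal (|e t ω'| ^ (2 + δ')) | ℱ t] ≤ᵐ[P] K t :=
    fun t => condLExp_rpow_le_one_add (ℱ.le t) (by positivity)
      (add_le_add_right (min_le_left _ _) _)
  have hKsup : ∀ᵐ ω ∂P, ⨆ t, K t ω < ∞ := by
    filter_upwards [hmom] with ω hω
    refine lt_of_le_of_lt (iSup_le fun t => ?_) (ENNReal.add_lt_top.2 ⟨ENNReal.one_lt_top, hω⟩)
    exact add_le_add_right
      (le_iSup (fun t => (P⁻[fun ω' => ENNReal.ofReal (|e t ω'| ^ (2 + δ)) | ℱ t]) ω) t) 1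
  suffices h : Tendsto (fun n => φ n * (Real.exp (v / 2) : ℝ)) atTop (𝓝 1) by
    have h2 := h.mul_const (Complex.exp (-v / 2 : ℝ))
    rw [one_mul] at h2
    refine h2.congr fun n => ?_
    rw [mul_assoc, Complex.ofReal_exp, ← Complex.exp_add, ← Complex.ofReal_add]
    ring_nf
    simp
  set c := Real.exp ((v + 1) / 2)
  have hc : 0 < c := Real.exp_pos _
  rw [Metric.tendsto_atTop']
  intro r hr
  -- Error budget: `r/5` from the martingale estimate, `r/10` from `c ρ`, and `6r/10` from three bad
  -- events of probability below `r/(10c)`, weighted by `2c`. The level `M` must be fixed before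
  -- `η`, whose choice depends on it.
  have hr' : 0 < r / (10 * c) := by positivity
  obtain ⟨M, hM⟩ := (((ENNReal.tendsto_toReal_zero_iff fun _ => measure_ne_top P _).2
    (tendsto_measure_exists_lt_of_iSup_lt_top (fun t => (hK t).mono (ℱ.le t) le_rfl)
      hKsup)).eventually_lt_const hr').exists
  obtain ⟨η, ⟨hη, hη1⟩, hηr⟩ : ∃ η : ℝ, (0 < η ∧ η ≤ 1) ∧
      c * (3 * M + 1) * η ^ δ' * (v + 1) < r / 5 := by
    have hcont : Continuous fun η : ℝ => c * (3 * M + 1) * η ^ δ' * (v + 1) :=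
      (continuous_const.mul (Real.continuous_rpow_const hδ'.le)).mul continuous_const
    have h0 : Tendsto (fun η : ℝ => c * (3 * M + 1) * η ^ δ' * (v + 1)) (𝓝[>] 0) (𝓝 0) := by
      have := (hcont.tendsto 0).mono_left (nhdsWithin_le_nhds (s := Set.Ioi 0))
      simpa [Real.zero_rpow hδ'.ne'] using this
    exact ((eventually_mem_set.2 (Ioc_mem_nhdsGT (zero_lt_one' ℝ))).and
      (h0.eventually_lt_const (by positivity : (0 : ℝ) < r / 5))).exists
  set ρ := min 1 (r / (10 * c))
  have hρ : 0 < ρ := lt_min one_pos hr'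
  have h1 := ((ENNReal.tendsto_toReal_zero_iff fun _ => measure_ne_top P _).2
    (hmax η hη)).eventually_lt_const hr'
  have h2 := ((ENNReal.tendsto_toReal_zero_iff fun _ => measure_ne_top P _).2
    (hvar ρ hρ)).eventually_lt_const hr'
  obtain ⟨N, hN⟩ := eventually_atTop.1 (h1.and h2)
  refine ⟨N, fun n hn => ?_⟩
  obtain ⟨hn1, hn2⟩ := hN n hn.le
  rw [dist_eq_norm]
  have hbound := norm_integral_exp_mul_exp_sub_one_le ℱ (n := n) hδ' (min_le_right _ _) hη hη1
    (Nat.cast_nonneg M) hv hρ.le (min_le_left _ _) (ha n) hem he he0 he1 hK hmomK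
  refine hbound.trans_lt ?_
  have hP : P.real ({ω | ∃ t < n, η < |a n t ω|} ∪ {ω | ∃ t, ENNReal.ofReal M < K t ω}
      ∪ {ω | ρ < |∑ t ∈ Finset.range n, a n t ω ^ 2 - v|}) < 3 * (r / (10 * c)) := by
    refine ((measureReal_union_le _ _).trans
      (add_le_add (measureReal_union_le _ _) le_rfl)).trans_lt ?_
    simp only [measureReal_def]
    linarith
  have hP' : 2 * c * P.real ({ω | ∃ t < n, η < |a n t ω|} ∪ {ω | ∃ t, ENNReal.ofReal M < K t ω}
      ∪ {ω | ρ < |∑ t ∈ Finset.range n, a n t ω ^ 2 - v|}) < 2 * c * (3 * (r / (10 * c))) := by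
    gcongr
  have hρ' : c * ρ ≤ c * (r / (10 * c)) := by
    gcongr
    exact min_le_right _ _
  have e1 : c * (r / (10 * c)) = r / 10 := by field_simp
  have e2 : 2 * c * (3 * (r / (10 * c))) = 6 * (r / 10) := by
    field_simp
    ring
  rw [e1] at hρ'
  rw [e2] at hP'
  linarith

end Limit

/-! ### Gaussian limit of the weighted noise. -/

section Noise

variable {Ω : Type*} {mΩ : MeasurableSpace Ω} {P : Measure Ω} {d : ℕ}
  {ℱ : Filtration ℕ mΩ} {x : ℕ → ℕ → Ω → EuclideanSpace ℝ (Fin d)} {y : ℕ → ℕ → Ω → ℝ}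
  {ε : ℕ → Ω → ℝ} {θ : EuclideanSpace ℝ (Fin d)} {σ δ : ℝ}
  {w : ℕ → ℕ → Ω → EuclideanSpace ℝ (Fin d)}

/-- The noise of the model is adapted. -/
lemma AdaptiveLinearModel.measurable_noise (h : AdaptiveLinearModel ℱ x y ε θ) (t : ℕ) :
    Measurable[ℱ (t + 1)] (ε (t + 1)) := by
  -- Responses are only known to be measurable strictly before the current time, so `y` and `x` of
  -- time `t + 1` are taken at horizon and current time `t + 2`, whose `σ`-field is `ℱ (t + 1)`.
  have hy := h.measurable_response (t + 2) (t + 2) (by omega) le_rfl (t + 1) (by omega) (by omega)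
  have hx := h.measurable_covariate (t + 2) (t + 2) (by omega) le_rfl (t + 1) (by omega) (by omega)
  have e : ε (t + 1) = fun ω => y (t + 2) (t + 1) ω - inner ℝ (x (t + 2) (t + 1) ω) θ := by
    ext ω
    rw [h.response_eq (t + 2) (t + 1) (by omega) (by omega)]
    ring
  rw [e]
  change Measurable[ℱ (t + 1)] (y (t + 2) (t + 1)) at hy
  change Measurable[ℱ (t + 1)] (x (t + 2) (t + 1)) at hx
  exact hy.sub (hx.inner_const (c := θ))

lemma NoiseCondition.condExp_div (h : NoiseCondition P ℱ ε σ δ) (t : ℕ) :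
    P[fun ω => ε (t + 1) ω / σ | ℱ t] =ᵐ[P] fun _ => (0 : ℝ) := by
  have h0 := h.condExp_eq_zero (t + 1) (by omega)
  have h1 := condExp_smul (μ := P) σ⁻¹ (ε (t + 1)) (ℱ t)
  have e : (fun ω => ε (t + 1) ω / σ) = σ⁻¹ • ε (t + 1) := by
    ext ω
    simp [div_eq_inv_mul]
  rw [e]
  filter_upwards [h0, h1] with ω h0 h1
  rw [h1]
  simp only [Pi.smul_apply, smul_eq_mul]
  rw [show ℱ t = ℱ (t + 1 - 1) by simp, h0, mul_zero]

lemma NoiseCondition.condExp_div_sq (h : NoiseCondition P ℱ ε σ δ) (hσ : 0 < σ) (t : ℕ) :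
    P[fun ω => (ε (t + 1) ω / σ) ^ 2 | ℱ t] =ᵐ[P] fun _ => (1 : ℝ) := by
  have h0 := h.condExp_sq (t + 1) (by omega)
  have h1 := condExp_smul (μ := P) (σ ^ 2)⁻¹ (fun ω => ε (t + 1) ω ^ 2) (ℱ t)
  have e : (fun ω => (ε (t + 1) ω / σ) ^ 2) = (σ ^ 2)⁻¹ • fun ω => ε (t + 1) ω ^ 2 := by
    ext ω
    simp [div_eq_inv_mul, mul_pow]
  rw [e]
  filter_upwards [h0, h1] with ω h0 h1
  rw [h1]
  simp only [Pi.smul_apply, smul_eq_mul]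
  rw [show ℱ t = ℱ (t + 1 - 1) by simp, h0, inv_mul_cancel₀ (by positivity)]

lemma NoiseCondition.iSup_condMoment_lt_top (h : NoiseCondition P ℱ ε σ δ) :
    ∀ᵐ ω ∂P, ⨆ t, (P⁻[fun ω' => ENNReal.ofReal (|ε (t + 1) ω' / σ| ^ (2 + δ)) | ℱ t]) ω < ∞ := by
  filter_upwards [h.condMoment_lt_top] with ω hω
  refine lt_of_le_of_lt (iSup_le fun t => ?_) hω
  exact le_iSup (fun t : {t : ℕ // 1 ≤ t} =>
    (P⁻[fun ω' => ENNReal.ofReal (|ε t ω' / σ| ^ (2 + δ)) | ℱ (t - 1)]) ω) ⟨t + 1, by omega⟩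

/-- The sum `∑ₜ (εₜ / σ) wₜ` of the normalized weighted noise up to time `n`. -/
noncomputable def weightedNoise (ε : ℕ → Ω → ℝ) (σ : ℝ)
    (w : ℕ → ℕ → Ω → EuclideanSpace ℝ (Fin d)) (n : ℕ) (ω : Ω) : EuclideanSpace ℝ (Fin d) :=
  ∑ t ∈ Finset.range n, (ε (t + 1) ω / σ) • w n (t + 1) ω

lemma inner_weightedNoise (n : ℕ) (ω : Ω) (u : EuclideanSpace ℝ (Fin d)) :
    inner ℝ (weightedNoise ε σ w n ω) u
      = ∑ t ∈ Finset.range n, inner ℝ (w n (t + 1) ω) u * (ε (t + 1) ω / σ) := by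
  simp [weightedNoise, sum_inner, real_inner_smul_left, mul_comm]

lemma measurable_weightedNoise (hmodel : AdaptiveLinearModel ℱ x y ε θ)
    (hpred : PredictableWeights ℱ w) (n : ℕ) : Measurable (weightedNoise ε σ w n) := by
  refine Finset.measurable_fun_sum _ fun t ht => ?_
  have h1 := (hmodel.measurable_noise t).mono (ℱ.le _) le_rfl
  have h2 := (hpred n (t + 1) (by omega) (Finset.mem_range.1 ht)).mono (ℱ.le _) le_rfl
  exact (h1.div_const σ).smul h2

/-- The sum is `‖W u‖² = ⟨u, Wᵀ W u⟩`. Thus the Gram condition controls the quadratic variation in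
every direction. -/
lemma sum_inner_sq_sub_norm_sq (n : ℕ) (w : ℕ → EuclideanSpace ℝ (Fin d))
    (u : EuclideanSpace ℝ (Fin d)) :
    ∑ t ∈ Finset.range n, inner ℝ (w (t + 1)) u ^ 2 - ‖u‖ ^ 2
      = -inner ℝ u (Matrix.toEuclideanCLM (𝕜 := ℝ)
        ((1 : Matrix (Fin d) (Fin d) ℝ) - (rowMatrix n w)ᵀ * rowMatrix n w) u) := by
  have h1 : ∀ t : Fin n, (rowMatrix n w *ᵥ u) t = inner ℝ (w (t + 1)) u := fun t => by
    simp [rowMatrix, Matrix.mulVec, dotProduct, PiLp.inner_apply, mul_comm]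
  have h2 : inner ℝ u u = ‖u‖ ^ 2 := real_inner_self_eq_norm_sq u
  rw [map_sub, map_one, _root_.sub_apply, inner_sub_right,
    one_apply_eq_self, h2, Matrix.inner_toEuclideanCLM, neg_sub]
  congr 1
  rw [Finset.sum_range fun t => inner ℝ (w (t + 1)) u ^ 2, ← Matrix.mulVec_mulVec,
    Matrix.dotProduct_mulVec, Matrix.vecMul_transpose]
  simp [dotProduct, h1, sq]

/-- The normalized weighted noise has asymptotically standard Gaussian characteristic function. -/
theorem tendsto_charFun_weightedNoise [IsProbabilityMeasure P] (hσ : 0 < σ) (hδ : 0 < δ)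
    (hmodel : AdaptiveLinearModel ℱ x y ε θ) (hnoise : NoiseCondition P ℱ ε σ δ)
    (hpred : PredictableWeights ℱ w) (hstable : StableWeights P w)
    (u : EuclideanSpace ℝ (Fin d)) :
    Tendsto (fun n => charFun (P.map (weightedNoise ε σ w n)) u) atTop
      (𝓝 (Complex.exp (-‖u‖ ^ 2 / 2 : ℝ))) := by
  have hchar : ∀ n, charFun (P.map (weightedNoise ε σ w n)) u
      = ∫ ω, Complex.exp ((∑ t ∈ Finset.range n,
        inner ℝ (w n (t + 1) ω) u * (ε (t + 1) ω / σ) : ℝ) * Complex.I) ∂P := fun n => by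
    rw [charFun_apply, integral_map (measurable_weightedNoise hmodel hpred n).aemeasurable
      (Measurable.aestronglyMeasurable (by fun_prop))]
    simp_rw [inner_weightedNoise]
  simp_rw [hchar]
  refine tendsto_integral_exp_martingale (a := fun n t ω => inner ℝ (w n (t + 1) ω) u)
    (e := fun t ω => ε (t + 1) ω / σ) ℱ hδ (sq_nonneg _) (fun n t ht => ?_)
    (fun t => ?_) (fun t => ?_) hnoise.condExp_div (hnoise.condExp_div_sq hσ)
    hnoise.iSup_condMoment_lt_top (fun η hη => ?_) (fun ρ hρ => ?_)
  · have h := hpred n (t + 1) (by omega) ht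
    change Measurable[ℱ t] (w n (t + 1)) at h
    exact h.inner_const (c := u)
  · exact (hmodel.measurable_noise t).div_const σ
  · have h := (hnoise.memLp_two (t + 1) (by omega)).const_mul σ⁻¹
    simpa only [div_eq_inv_mul] using h
  -- The `+ 1` in the threshold covers `u = 0`.
  · have h := tendstoInMeasure_iff_norm.1 hstable.max_norm (η / (‖u‖ + 1)) (by positivity)
    refine tendsto_of_tendsto_of_tendsto_of_le_of_le tendsto_const_nhds h (fun _ => zero_le)
      fun n => measure_mono ?_
    rintro ω ⟨t, ht, hω⟩
    have h1 : ‖w n (t + 1) ω‖ ≤ ⨆ i : Fin n, ‖w n (i + 1) ω‖ :=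
      le_ciSup (f := fun i : Fin n => ‖w n (i + 1) ω‖) (Set.finite_range _).bddAbove ⟨t, ht⟩
    have h2 := abs_real_inner_le_norm (w n (t + 1) ω) u
    have h3 : ‖w n (t + 1) ω‖ * ‖u‖ ≤ ‖w n (t + 1) ω‖ * (‖u‖ + 1) := by
      gcongr
      linarith
    change η / (‖u‖ + 1) ≤ ‖(⨆ i : Fin n, ‖w n (i + 1) ω‖) - 0‖
    rw [sub_zero]
    refine le_trans ?_ (h1.trans (Real.le_norm_self _))
    rw [div_le_iff₀ (by positivity)]
    linarith
  · have h := tendstoInMeasure_iff_norm.1 hstable.gram (ρ / (‖u‖ ^ 2 + 1)) (by positivity)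
    refine tendsto_of_tendsto_of_tendsto_of_le_of_le tendsto_const_nhds h (fun _ => zero_le)
      fun n => measure_mono ?_
    intro ω hω
    simp only [Set.mem_ofPred_eq] at hω ⊢
    rw [sum_inner_sq_sub_norm_sq n (fun t => w n t ω) u, abs_neg] at hω
    set A := Matrix.toEuclideanCLM (𝕜 := ℝ) ((1 : Matrix (Fin d) (Fin d) ℝ)
      - (rowMatrix n fun t => w n t ω)ᵀ * (rowMatrix n fun t => w n t ω))
    have h1 := abs_real_inner_le_norm u (A u)
    have h2 := A.le_opNorm u
    have h3 : ‖u‖ * ‖A u‖ ≤ ‖u‖ * (‖A‖ * ‖u‖) := by gcongr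
    have h4 := norm_nonneg A
    rw [sub_zero, norm_norm, div_le_iff₀ (by positivity)]
    nlinarith

end Noise

/-! ### Singular values and the linear form of the error. -/

section SingularValues

variable {d n : ℕ} {W U : Matrix (Fin n) (Fin d) ℝ} {l : Fin d → ℝ} {V : Matrix (Fin d) (Fin d) ℝ}

-- The operator norm is invariant under orthogonal factors, and that of a diagonal matrix is its
-- largest absolute entry.
open scoped Matrix.Norms.L2Operator in
lemma norm_toEuclideanCLM_conj_diagonal (hV : V ∈ Matrix.orthogonalGroup (Fin d) ℝ)
    (v : Fin d → ℝ) :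
    ‖Matrix.toEuclideanCLM (𝕜 := ℝ) (V * Matrix.diagonal v * Vᵀ)‖ = ‖v‖ := by
  have hV' : Vᵀ ∈ unitary (Matrix (Fin d) (Fin d) ℝ) := by
    have := Unitary.star_mem hV
    rwa [Matrix.star_eq_conjTranspose, Matrix.conjTranspose_eq_transpose_of_trivial] at this
  rw [← Matrix.l2_opNorm_diagonal (𝕜 := ℝ) v, ← Matrix.cstar_norm_def,
    CStarRing.norm_mul_mem_unitary _ hV', CStarRing.norm_mem_unitary_mul _ hV]

namespace IsSVD

lemma transpose_mul_right (h : IsSVD W U l V) : Vᵀ * V = 1 := by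
  have := Matrix.mem_orthogonalGroup_iff' (Fin d) ℝ |>.1 h.right_orthogonal
  simpa using this

lemma mul_transpose_right (h : IsSVD W U l V) : V * Vᵀ = 1 := by
  have := Matrix.mem_orthogonalGroup_iff (Fin d) ℝ |>.1 h.right_orthogonal
  simpa using this

lemma one_sub_gram (h : IsSVD W U l V) :
    1 - Wᵀ * W = V * Matrix.diagonal (fun j => 1 - l j ^ 2) * Vᵀ := by
  have h1 : Wᵀ * W = V * Matrix.diagonal (fun j => l j ^ 2) * Vᵀ := by
    rw [h.eq_mul]
    simp only [Matrix.transpose_mul, Matrix.transpose_transpose, Matrix.diagonal_transpose]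
    calc V * (Matrix.diagonal l * Uᵀ) * (U * Matrix.diagonal l * Vᵀ)
        = V * (Matrix.diagonal l * (Uᵀ * U) * Matrix.diagonal l) * Vᵀ := by
          simp only [Matrix.mul_assoc]
      _ = _ := by
          rw [h.left_orthonormal, Matrix.mul_one, Matrix.diagonal_mul_diagonal]
          simp only [sq]
  have h2 : Matrix.diagonal (fun j => 1 - l j ^ 2)
      = (1 : Matrix (Fin d) (Fin d) ℝ) - Matrix.diagonal (fun j => l j ^ 2) := by
    rw [← Matrix.diagonal_one, Matrix.diagonal_sub]
  rw [h1, h2, Matrix.mul_sub, Matrix.sub_mul, Matrix.mul_one, h.mul_transpose_right]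

lemma abs_one_sub_sq_le (h : IsSVD W U l V) (j : Fin d) :
    |1 - l j ^ 2| ≤ ‖Matrix.toEuclideanCLM (𝕜 := ℝ) ((1 : Matrix (Fin d) (Fin d) ℝ) - Wᵀ * W)‖ := by
  rw [h.one_sub_gram, norm_toEuclideanCLM_conj_diagonal h.right_orthogonal]
  exact norm_le_pi_norm (fun j => 1 - l j ^ 2) j

lemma singularValue_pos (h : IsSVD W U l V)
    (hr : ‖Matrix.toEuclideanCLM (𝕜 := ℝ) ((1 : Matrix (Fin d) (Fin d) ℝ) - Wᵀ * W)‖ ≤ 1 / 2) (j : Fin d) : 0 < l j := by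
  have h1 := (abs_le.1 ((h.abs_one_sub_sq_le j).trans hr)).2
  have h2 := h.nonneg j
  by_contra h3
  have h4 : l j = 0 := le_antisymm (not_lt.1 h3) h2
  rw [h4] at h1
  norm_num at h1

/-- On each singular value, `|1/l - 1| = |1 - l²| / (l (1 + l))`, and `l² ≥ 1/2` gives `2 l (1 + l)
≥ 1`. -/
lemma norm_conj_inv_sub_one_le (h : IsSVD W U l V)
    (hr : ‖Matrix.toEuclideanCLM (𝕜 := ℝ) ((1 : Matrix (Fin d) (Fin d) ℝ) - Wᵀ * W)‖ ≤ 1 / 2) :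
    ‖Matrix.toEuclideanCLM (𝕜 := ℝ) (V * Matrix.diagonal (fun j => (l j)⁻¹) * Vᵀ) - 1‖
      ≤ 2 * ‖Matrix.toEuclideanCLM (𝕜 := ℝ) ((1 : Matrix (Fin d) (Fin d) ℝ) - Wᵀ * W)‖ := by
  have h1 : V * Matrix.diagonal (fun j => (l j)⁻¹) * Vᵀ - 1
      = V * Matrix.diagonal (fun j => (l j)⁻¹ - 1) * Vᵀ := by
    have h2 : Matrix.diagonal (fun j => (l j)⁻¹ - 1)
        = Matrix.diagonal (fun j => (l j)⁻¹) - (1 : Matrix (Fin d) (Fin d) ℝ) := by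
      rw [← Matrix.diagonal_one, Matrix.diagonal_sub]
    rw [h2, Matrix.mul_sub, Matrix.sub_mul, Matrix.mul_one, h.mul_transpose_right]
  rw [← map_one (Matrix.toEuclideanCLM (𝕜 := ℝ) (n := Fin d)), ← map_sub, h1,
    norm_toEuclideanCLM_conj_diagonal h.right_orthogonal]
  refine (pi_norm_le_iff_of_nonneg (by positivity)).2 fun j => ?_
  have hj := h.singularValue_pos hr j
  have h3 := h.abs_one_sub_sq_le j
  have h4 := (abs_le.1 (h3.trans hr)).2
  have e : 1 - l j ^ 2 = (1 - l j) * (1 + l j) := by ring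
  have e2 : (l j)⁻¹ - 1 = (1 - l j) / l j := by field_simp
  rw [e, abs_mul, abs_of_pos (by linarith : 0 < 1 + l j)] at h3
  rw [Real.norm_eq_abs, e2, abs_div, abs_of_pos hj, div_le_iff₀ hj]
  have h5 := abs_nonneg (1 - l j)
  have h6 : 1 ≤ 2 * l j * (1 + l j) := by nlinarith
  nlinarith

/-- `V Λ⁻¹ Vᵀ` cancels the factor `Λ` of `Wᵀ = V Λ Uᵀ`, whichever decomposition is chosen. -/
lemma conj_inv_mul_transpose_mul (h : IsSVD W U l V) (hl : ∀ j, 0 < l j)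
    (X : Matrix (Fin n) (Fin d) ℝ) :
    V * Matrix.diagonal (fun j => (l j)⁻¹) * Vᵀ * (Wᵀ * X) = affinityMatrix U X V := by
  rw [h.eq_mul, affinityMatrix]
  simp only [Matrix.transpose_mul, Matrix.transpose_transpose, Matrix.diagonal_transpose]
  calc V * Matrix.diagonal (fun j => (l j)⁻¹) * Vᵀ * (V * (Matrix.diagonal l * Uᵀ) * X)
      = V * (Matrix.diagonal (fun j => (l j)⁻¹) * (Vᵀ * V) * Matrix.diagonal l) * Uᵀ * X := by
        simp only [Matrix.mul_assoc]
    _ = V * Uᵀ * X := by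
        rw [h.transpose_mul_right, Matrix.mul_one, Matrix.diagonal_mul_diagonal]
        simp [(hl _).ne']

end IsSVD

lemma toEuclideanCLM_transpose_mul_rowMatrix (n : ℕ) (w x : ℕ → EuclideanSpace ℝ (Fin d))
    (z : EuclideanSpace ℝ (Fin d)) :
    Matrix.toEuclideanCLM (𝕜 := ℝ) ((rowMatrix n w)ᵀ * rowMatrix n x) z
      = ∑ t ∈ Finset.range n, inner ℝ (x (t + 1)) z • w (t + 1) := by
  ext j
  rw [Matrix.ofLp_toEuclideanCLM, ← Matrix.mulVec_mulVec,
    Finset.sum_range fun t => inner ℝ (x (t + 1)) z • w (t + 1)]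
  simp [rowMatrix, Matrix.mulVec, dotProduct, PiLp.inner_apply, mul_comm]

/-- On the event that the estimating equation is solved, the normalized error is a linear image of
the weighted noise. -/
lemma normalizedError_eq {w x : ℕ → EuclideanSpace ℝ (Fin d)} {y ε : ℕ → ℝ}
    {θhat θ : EuclideanSpace ℝ (Fin d)} {σhat : ℝ} (h : IsSVD (rowMatrix n w) U l V)
    (hl : ∀ j, 0 < l j) (hy : ∀ t, 1 ≤ t → t ≤ n → y t = inner ℝ (x t) θ + ε t)
    (hsol : SolvesALEE n w x y θhat) :
    normalizedError U (rowMatrix n x) V θhat θ σhat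
      = σhat⁻¹ • Matrix.toEuclideanCLM (𝕜 := ℝ) (V * Matrix.diagonal (fun j => (l j)⁻¹) * Vᵀ)
        (∑ t ∈ Finset.range n, ε (t + 1) • w (t + 1)) := by
  have hsol' : ∑ t ∈ Finset.range n, (y (t + 1) - inner ℝ (x (t + 1)) θhat) • w (t + 1) = 0 := by
    have h1 : Finset.Icc 1 n = Finset.Ico (0 + 1) (n + 1) := by
      ext t
      simp only [Finset.mem_Icc, Finset.mem_Ico]
      omega
    rw [SolvesALEE, h1] at hsol
    rw [Finset.range_eq_Ico,
      Finset.sum_Ico_add' (fun t => (y t - inner ℝ (x t) θhat) • w t) 0 n 1, hsol]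
  have hsum : ∑ t ∈ Finset.range n, ε (t + 1) • w (t + 1)
      = ∑ t ∈ Finset.range n, inner ℝ (x (t + 1)) (θhat - θ) • w (t + 1) := by
    rw [← sub_eq_zero, ← Finset.sum_sub_distrib, ← hsol']
    refine Finset.sum_congr rfl fun t ht => ?_
    rw [← sub_smul, hy (t + 1) (by omega) (Finset.mem_range.1 ht), inner_sub_right]
    congr 1
    ring
  rw [hsum, ← toEuclideanCLM_transpose_mul_rowMatrix, ← mul_apply_eq_comp, ← map_mul,
    h.conj_inv_mul_transpose_mul hl, normalizedError]

end SingularValues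

/-! ### Perturbation bounds for the Slutsky argument. -/

section Slutsky

lemma norm_smul_apply_sub_le {E : Type*} [NormedAddCommGroup E] [NormedSpace ℝ E] (N : E →L[ℝ] E)
    {r c : ℝ} (hN : ‖N - 1‖ ≤ 2 * r) (hr : r ≤ 1 / 2) (s : E) :
    ‖c • N s - s‖ ≤ (2 * |c - 1| + 2 * r) * ‖s‖ := by
  -- This separates the scalar error from the operator error; `(N - 1) s + s = N s` has norm at most
  -- `2 ‖s‖` because `2 r ≤ 1`.
  have e : c • N s - s = (c - 1) • ((N - 1) s + s) + (N - 1) s := by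
    simp [sub_smul]
  have h1 : ‖(N - 1) s‖ ≤ 2 * r * ‖s‖ := (N - 1).le_of_opNorm_le hN s
  have h2 : ‖(N - 1) s + s‖ ≤ 2 * ‖s‖ := by
    refine (norm_add_le _ _).trans ?_
    have := norm_nonneg s
    nlinarith
  rw [e]
  refine (norm_add_le _ _).trans ?_
  rw [norm_smul, Real.norm_eq_abs]
  have := mul_le_mul_of_nonneg_left h2 (abs_nonneg (c - 1))
  linarith

lemma abs_div_sub_one_le {σ σhat s : ℝ} (hσ : 0 < σ) (hs : s ≤ σ / 2) (h : |σhat - σ| < s) :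
    |σ / σhat - 1| ≤ 2 * s / σ := by
  have h1 := abs_lt.1 h
  have h2 : σ / 2 ≤ σhat := by linarith
  have h3 : 0 < σhat := by linarith
  have e : σ / σhat - 1 = (σ - σhat) / σhat := by field_simp
  rw [e, abs_div, abs_of_pos h3, abs_sub_comm, div_le_div_iff₀ h3 hσ]
  have := abs_nonneg (σhat - σ)
  nlinarith

end Slutsky

end ALEE

/-! ### The main theorem. -/

/-- Asymptotic normality of the ALEE estimator. The weights may depend on the horizon `n` (`w n t`
is the weight of time `t` at horizon `n`). The estimating equation only has to be solvable, and
solved by `θhat n`, with probability tending to one. The hypothesis `hmeas` only says that the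
statistic is a random vector. -/
theorem proposition1 {Ω : Type*} {mΩ : MeasurableSpace Ω} {P : Measure Ω} [IsProbabilityMeasure P]
    {d : ℕ} (ℱ : Filtration ℕ mΩ)
    (x : ℕ → ℕ → Ω → EuclideanSpace ℝ (Fin d)) (y : ℕ → ℕ → Ω → ℝ) (ε : ℕ → Ω → ℝ)
    (θ : EuclideanSpace ℝ (Fin d)) (σ δ : ℝ) (hσ : 0 < σ) (hδ : 0 < δ)
    (hmodel : ALEE.AdaptiveLinearModel ℱ x y ε θ)
    (hnoise : ALEE.NoiseCondition P ℱ ε σ δ)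
    (w : ℕ → ℕ → Ω → EuclideanSpace ℝ (Fin d))
    (hpred : ALEE.PredictableWeights ℱ w)
    (hstable : ALEE.StableWeights P w)
    (U : (n : ℕ) → Ω → Matrix (Fin n) (Fin d) ℝ) (l : ℕ → Ω → Fin d → ℝ)
    (V : ℕ → Ω → Matrix (Fin d) (Fin d) ℝ)
    (hsvd : ∀ n, d ≤ n → ∀ᵐ ω ∂P,
      ALEE.IsSVD (ALEE.rowMatrix n fun t => w n t ω) (U n ω) (l n ω) (V n ω))
    (θhat : ℕ → Ω → EuclideanSpace ℝ (Fin d))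
    (hθhat : Tendsto (fun n => P {ω | ¬ ALEE.SolvesALEE n (fun t => w n t ω) (fun t => x n t ω)
      (fun t => y n t ω) (θhat n ω)}) atTop (𝓝 0))
    (σhat : ℕ → Ω → ℝ)
    (hσhat : TendstoInMeasure P σhat atTop fun _ => σ)
    (hmeas : ∀ n, AEMeasurable (fun ω => ALEE.normalizedError (U n ω)
      (ALEE.rowMatrix n fun t => x n t ω) (V n ω) (θhat n ω) θ (σhat n ω)) P) :
    TendstoInDistribution
      (fun n ω => ALEE.normalizedError (U n ω)
        (ALEE.rowMatrix n fun t => x n t ω) (V n ω) (θhat n ω) θ (σhat n ω))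
      atTop (id : EuclideanSpace ℝ (Fin d) → EuclideanSpace ℝ (Fin d)) (fun _ => P)
      (multivariateGaussian 0 (1 : Matrix (Fin d) (Fin d) ℝ)) := by
  set S := ALEE.weightedNoise ε σ w with hS
  have hSm : ∀ n, Measurable (S n) := ALEE.measurable_weightedNoise hmodel hpred
  have hchar := ALEE.tendsto_charFun_weightedNoise hσ hδ hmodel hnoise hpred hstable
  have hprob : ∀ n, IsProbabilityMeasure (P.map (S n)) := fun n =>
    Measure.isProbabilityMeasure_map (hSm n).aemeasurable
  have hclt : TendstoInDistribution S atTop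
      (id : EuclideanSpace ℝ (Fin d) → EuclideanSpace ℝ (Fin d)) (fun _ => P)
      (multivariateGaussian 0 (1 : Matrix (Fin d) (Fin d) ℝ)) := by
    refine ⟨fun n => (hSm n).aemeasurable, aemeasurable_id, ?_⟩
    refine ProbabilityMeasure.tendsto_iff_tendsto_charFun.2 fun u => ?_
    have h := hchar u
    simp only [ProbabilityMeasure.coe_mk, Measure.map_id, multivariateGaussian_zero_one,
      charFun_stdGaussian]
    push_cast at h
    exact h
  -- Convergence of the characteristic functions to a function continuous at zero already gives
  -- tightness.
  have htight : IsTightMeasureSet (Set.range fun n => P.map (S n)) :=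
    isTightMeasureSet_of_tendsto_charFun (Continuous.continuousAt (by fun_prop)) hchar
  refine tendstoInDistribution_of_tendstoInMeasure_sub _ _ hclt ?_ hmeas
  rw [tendstoInMeasure_iff_norm]
  intro κ hκ
  rw [ENNReal.tendsto_nhds_zero]
  intro τ hτ
  have hτ2 : 0 < τ / 2 := ENNReal.half_pos hτ.ne'
  obtain ⟨R, hR, hR0⟩ := (((ENNReal.tendsto_nhds_zero.1
    (tendsto_measure_norm_gt_of_isTightMeasureSet htight)) (τ / 2) hτ2).and
    (eventually_ge_atTop 0)).exists
  have hR' : ∀ n, P {ω | R < ‖S n ω‖} ≤ τ / 2 := fun n => by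
    have h1 := (le_iSup₂ (f := fun μ (_ : μ ∈ Set.range fun n => P.map (S n)) =>
      μ {z | R < ‖z‖}) (P.map (S n)) ⟨n, rfl⟩).trans hR
    rwa [Measure.map_apply (hSm n) (measurableSet_lt measurable_const measurable_norm)] at h1
  -- Both `|σ/σhat - 1|` and the Gram error become at most `κ/(8(R + 1))`; the factors `2 + 2` and
  -- `‖S n‖ ≤ R` then give a difference of at most `κ/2`. Using `R + 1` avoids dividing by zero.
  set s := min (σ / 2) (σ * κ / (16 * (R + 1))) with hs_def
  set r := min (1 / 2 : ℝ) (κ / (8 * (R + 1))) with hr_def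
  have hs : 0 < s := by positivity
  have hr : 0 < r := by positivity
  have hgram := tendstoInMeasure_iff_norm.1 hstable.gram r hr
  have hσ' := tendstoInMeasure_iff_norm.1 hσhat s hs
  have hlim := (hgram.add hσ').add hθhat
  simp only [add_zero] at hlim
  filter_upwards [ENNReal.tendsto_nhds_zero.1 hlim (τ / 2) hτ2, eventually_ge_atTop d] with n hn hdn
  refine le_trans ?_ ((add_le_add hn (hR' n)).trans_eq (ENNReal.add_halves τ))
  -- Only monotonicity and subadditivity of `P` are used, so the exceptional events need not be
  -- measurable.
  refine le_trans (measure_mono_ae ?_) (measure_union_le _ _ |>.trans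
    (add_le_add ((measure_union_le _ _).trans (add_le_add (measure_union_le _ _) le_rfl)) le_rfl))
  filter_upwards [hsvd n hdn] with ω hω hbig
  by_contra hnot
  change ¬ (((_ ∨ _) ∨ _) ∨ _) at hnot
  simp only [not_or] at hnot
  obtain ⟨⟨⟨hg, hsg⟩, hsol⟩, hSR⟩ := hnot
  simp only [Set.mem_ofPred_eq, not_le, not_lt, not_not] at hg hsg hsol hSR
  rw [sub_zero, norm_norm] at hg
  rw [Real.norm_eq_abs] at hsg
  set ϱ := ‖Matrix.toEuclideanCLM (𝕜 := ℝ) ((1 : Matrix (Fin d) (Fin d) ℝ)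
        - (ALEE.rowMatrix n fun t => w n t ω)ᵀ * (ALEE.rowMatrix n fun t => w n t ω))‖
  have hϱ : ϱ ≤ 1 / 2 := hg.le.trans (min_le_left _ _)
  have heq := ALEE.normalizedError_eq (ε := fun t => ε t ω) (σhat := σhat n ω) hω
    (hω.singularValue_pos hϱ) (fun t h1 h2 => hmodel.response_eq n t h1 h2 ω) hsol
  have hsum : ∑ t ∈ Finset.range n, ε (t + 1) ω • w n (t + 1) ω = σ • S n ω := by
    rw [hS, ALEE.weightedNoise, Finset.smul_sum]
    refine Finset.sum_congr rfl fun t _ => ?_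
    rw [smul_smul, mul_div_cancel₀ _ hσ.ne']
  rw [hsum, map_smul, smul_smul, inv_mul_eq_div] at heq
  have hbound := ALEE.norm_smul_apply_sub_le _ (c := σ / σhat n ω)
    (hω.norm_conj_inv_sub_one_le hϱ) hϱ (S n ω)
  rw [← heq] at hbound
  have hratio := ALEE.abs_div_sub_one_le hσ (min_le_left _ _) hsg
  have h1 : 2 * s / σ ≤ κ / (8 * (R + 1)) := by
    have : s ≤ σ * κ / (16 * (R + 1)) := min_le_right _ _
    calc 2 * s / σ ≤ 2 * (σ * κ / (16 * (R + 1))) / σ := by gcongr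
      _ = κ / (8 * (R + 1)) := by
        field_simp
        norm_num
  have h2 : ϱ ≤ κ / (8 * (R + 1)) := hg.le.trans (min_le_right _ _)
  have h3 : (2 * |σ / σhat n ω - 1| + 2 * ϱ) * ‖S n ω‖ ≤ (4 * (κ / (8 * (R + 1)))) * (R + 1) := by
    refine mul_le_mul ?_ (by linarith) (norm_nonneg _) (by positivity)
    linarith
  have h4 : (4 * (κ / (8 * (R + 1)))) * (R + 1) = κ / 2 := by
    field_simp
    norm_num
  have h5 : κ ≤ ‖ALEE.normalizedError (U n ω) (ALEE.rowMatrix n fun t => x n t ω) (V n ω)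
      (θhat n ω) θ (σhat n ω) - S n ω‖ := by
    have : κ ≤ ‖(_ - S n ω : EuclideanSpace ℝ (Fin d)) - 0‖ := hbig
    rwa [sub_zero] at this
  linarith
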